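/- Let $N\ge 2$ and $n\ge 2$ be integers. A *frieze* of width $n$ over a commutative ring $R$ is a function $(i,j)\mapsto m_{i,j}\in R$ on $\{(i,j)\in\mathbb Z^2: 0\le i-j\le n\}$ with $m_{i,i}=m_{n+i,i}=0$ for $i\in\mathbb Z$ and $m_{i,j}m_{i+1,j+1}-m_{i,j+1}m_{i+1,j}=1$ for $0<i-j<n$. It is *tame* if the $3\times 3$ block of contiguous entries centred at $(i,j)$ has determinant $0$ whenever $1<i-j<n-1$, and *semiregular* if $m_{i+1,i}=1$ for all $i$. A function $\mathbf M:\mathbb Z\times\mathbb Z\to R$ is a *tame $\mathrm{SL}_2$-tiling* if all its contiguous $2\times 2$ blocks have determinant $1$ and all its contiguous $3\times 3$ blocks have determinant $0$; it is the *extension* of a tame frieze $\mathbf F$ of width $n$ if it agrees with $\mathbf F$ for $0\le i-j\le n$. A tame frieze $\widetilde{\mathbf F}$ of width $n$ over $\mathbb Z$ is a *lift* of a frieze $\mathbf F$ of width $n$ over $\mathbb Z/N\mathbb Z$ if reducing the entries of $\widetilde{\mathbf F}$ modulo $N$ gives $\mathbf F$. A pair $(a,b)\in R^2$ is *unimodular*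 if $aR+bR=R$. Let $\mathscr E_R$ be the directed graph whose vertices are the unimodular pairs, with an edge from $(a,b)$ to $(c,d)$ if $ad-bc=1$. The Farey complex $\mathscr F_N$ has as vertices the orbits $\pm(a,b)$ of unimodular pairs over $R=\mathbb Z/N\mathbb Z$, with $\pm(a,b)$ and $\pm(c,d)$ adjacent if $ad-bc=\pm1$; its faces are the triples of mutually adjacent vertices. A path $\gamma=\langle v_0,\dots,v_n\rangle$ of length $n$ in $\mathscr F_N$ with $v_n=\lambda v_0$ for some $\lambda\in R^\times$ *corresponds* to a tame semiregular frieze $\mathbf F$ of width $n$ over $R$ if there are a bi-infinite path in $\mathscr E_R$ with vertices $(a_i,b_i)$, $i\in\mathbb Z$, and a unit $\lambda\in R^\times$, such that $v_i=\pm(a_i,b_i)$ for $0\le i\le n$, $(a_{i+n},b_{i+n})=\lambda^{(-1)^i}(a_i,b_i)$ for all $i\in\mathbb Z$, and the tiling with entries $a_jb_i-b_ja_i$ is the extension of $\mathbf F$. A closed path in $\mathscr F_N$ is *strongly contractible* if it can be transformed to a single vertex by finitely many operations of the following two kinds: replace a subpath $\langle v,u,v\rangle$ with $\langle v\rangle$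 (removal of a spur); replace a subpath $\langle u,v,w\rangle$, where $u,v,w$ are mutually adjacent, with $\langle u,w\rangle$ (deformation over a triangular face). **Theorem.** A tame semiregular frieze $\mathbf F$ of width $n$ over $\mathbb Z/N\mathbb Z$ lifts to a tame frieze of width $n$ over $\mathbb Z$ if and only if every path $\gamma$ in $\mathscr F_N$ corresponding to $\mathbf F$ is a strongly contractible closed path. -/

import Mathlib

/-! ### Friezes and SL₂-tilings -/

/-- The determinant of the contiguous 3-by-3 block of the array `M` with centre `(i, j)`. -/
def blockDet {R : Type*} [CommRing R] (M : ℤ → ℤ → R) (i j : ℤ) : R :=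
  Matrix.det !![M (i - 1) (j - 1), M (i - 1) j, M (i - 1) (j + 1);
                M i (j - 1), M i j, M i (j + 1);
                M (i + 1) (j - 1), M (i + 1) j, M (i + 1) (j + 1)]

/-- `F` is a frieze of width `n`. A frieze is a function on the strip `0 ≤ i - j ≤ n`; it is
represented by a function on all pairs, of which only the values on the strip are ever used. -/
structure IsFrieze {R : Type*} [CommRing R] (n : ℕ) (F : ℤ → ℤ → R) : Prop where
  top_zero : ∀ i : ℤ, F i i = 0
  bottom_zero : ∀ i : ℤ, F (n + i) i = 0
  diamond : ∀ i j : ℤ, 0 < i - j → i - j < n →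
    F i j * F (i + 1) (j + 1) - F i (j + 1) * F (i + 1) j = 1

/-- A tame frieze: every 3-by-3 block that lies inside the strip has determinant `0`. -/
structure IsTameFrieze {R : Type*} [CommRing R] (n : ℕ) (F : ℤ → ℤ → R) : Prop
    extends IsFrieze n F where
  tame : ∀ i j : ℤ, 1 < i - j → i - j < n - 1 → blockDet F i j = 0

/-- Semiregular: the second row consists of 1s. -/
def IsSemiregular {R : Type*} [CommRing R] (F : ℤ → ℤ → R) : Prop :=
  ∀ i : ℤ, F (i + 1) i = 1

/-- A tame SL₂-tiling. -/
structure IsTameTiling {R : Type*} [CommRing R] (M : ℤ → ℤ → R) : Prop where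
  sl2 : ∀ i j : ℤ, M i j * M (i + 1) (j + 1) - M i (j + 1) * M (i + 1) j = 1
  tame : ∀ i j : ℤ, blockDet M i j = 0

/-- `M` is the extension of the frieze `F` of width `n` to a tame SL₂-tiling. -/
def IsExtension {R : Type*} [CommRing R] (n : ℕ) (F M : ℤ → ℤ → R) : Prop :=
  IsTameTiling M ∧ ∀ i j : ℤ, 0 ≤ i - j → i - j ≤ n → M i j = F i j

/-- The array `G` over `ℤ` reduces modulo `N` to the frieze `F` of width `n`. -/
def IsLiftOf {N : ℕ} (n : ℕ) (G : ℤ → ℤ → ℤ) (F : ℤ → ℤ → ZMod N) : Prop :=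
  ∀ i j : ℤ, 0 ≤ i - j → i - j ≤ n → ((G i j : ℤ) : ZMod N) = F i j

/-! ### Farey complexes -/

/-- A unimodular pair `(a, b)`: there are `x, y` with `x * a + y * b = 1`. These are the vertices
of the Farey complex `ℰ_R` (the one with group of units `{1}`). -/
@[ext]
structure UnimodularPair (R : Type*) [CommRing R] where
  fst : R
  snd : R
  coprime : IsCoprime fst snd

namespace UnimodularPair

/-- Units act on unimodular pairs by `c • (a, b) = (c a, c b)`. -/
instance {R : Type*} [CommRing R] : MulAction Rˣ (UnimodularPair R) where
  smul c p := ⟨c * p.fst, c * p.snd,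
    (isCoprime_mul_unit_left c.isUnit p.fst p.snd).2 p.coprime⟩
  one_smul p := UnimodularPair.ext (one_mul p.fst) (one_mul p.snd)
  mul_smul c d p := UnimodularPair.ext (mul_assoc (c : R) d p.fst) (mul_assoc (c : R) d p.snd)

/-- `a d - b c` for the pairs `p = (a, b)` and `q = (c, d)`. -/
def det {R : Type*} [CommRing R] (p q : UnimodularPair R) : R :=
  p.fst * q.snd - p.snd * q.fst

end UnimodularPair

/-- The group of units `{±1}`. -/
def signUnits (R : Type*) [CommRing R] : Subgroup Rˣ where
  carrier := {c | c = 1 ∨ c = -1}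
  one_mem' := Or.inl rfl
  mul_mem' := by
    rintro a b (rfl | rfl) (rfl | rfl) <;> simp
  inv_mem' := by
    rintro a (rfl | rfl) <;> simp

/-- The vertices of the Farey complex `ℱ_R = ℱ_{R, {±1}}`: the orbits of `{±1}` on unimodular
pairs. -/
abbrev FareyVertex (R : Type*) [CommRing R] : Type _ :=
  MulAction.orbitRel.Quotient (signUnits R) (UnimodularPair R)

/-- The vertex `a/b` of `ℱ_R` given by a unimodular pair `(a, b)`; this is the covering map
`ℰ_R → ℱ_R` on vertices. -/
def FareyVertex.mk {R : Type*} [CommRing R] (p : UnimodularPair R) : FareyVertex R :=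
  Quotient.mk _ p

/-- There is an edge from `a/b` to `c/d` in `ℱ_R` if `a d - b c ∈ {±1}`. This condition does not
depend on the representatives and is symmetric. -/
def FareyAdj {R : Type*} [CommRing R] (u v : FareyVertex R) : Prop :=
  ∃ p q : UnimodularPair R, FareyVertex.mk p = u ∧ FareyVertex.mk q = v ∧
    (p.det q = 1 ∨ p.det q = -1)

/-! ### Finite paths in `ℱ_R` and strong contractibility -/

/-- The list `⟨v₀, v₁, …, vₙ⟩` is a path in `ℱ_R` (of length `n`, one less than the number of
its vertices). -/
def IsFareyPath {R : Type*} [CommRing R] (γ : List (FareyVertex R)) : Prop :=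
  γ ≠ [] ∧ γ.IsChain FareyAdj

/-- A closed path: the initial and the final vertex coincide. -/
def IsClosedFareyPath {R : Type*} [CommRing R] (γ : List (FareyVertex R)) : Prop :=
  IsFareyPath γ ∧ γ.head? = γ.getLast?

/-- The elementary homotopies. -/
inductive ElementaryHomotopy {R : Type*} [CommRing R] :
    List (FareyVertex R) → List (FareyVertex R) → Prop
  /-- Replace a subpath `⟨v, u, v⟩` with `⟨v⟩`. -/
  | spur (l₁ l₂ : List (FareyVertex R)) (u v : FareyVertex R) :
      ElementaryHomotopy (l₁ ++ [v, u, v] ++ l₂) (l₁ ++ [v] ++ l₂)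
  /-- Replace a subpath `⟨u, v, w⟩` with `⟨u, w⟩`, where `u, v, w` are mutually adjacent. -/
  | triangle (l₁ l₂ : List (FareyVertex R)) (u v w : FareyVertex R) :
      FareyAdj u v → FareyAdj v w → FareyAdj u w →
      ElementaryHomotopy (l₁ ++ [u, v, w] ++ l₂) (l₁ ++ [u, w] ++ l₂)

/-- A strongly contractible closed path: finitely many elementary homotopies transform it to a
path that consists of a single vertex. -/
def IsStronglyContractible {R : Type*} [CommRing R] (γ : List (FareyVertex R)) : Prop :=
  IsClosedFareyPath γ ∧ ∃ v : FareyVertex R, Relation.ReflTransGen ElementaryHomotopy γ [v]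

/-! ### The correspondence between paths and friezes -/

/-- A bi-infinite path in `ℰ_R`. -/
def IsBiinfinitePath {R : Type*} [CommRing R] (δ : ℤ → UnimodularPair R) : Prop :=
  ∀ i : ℤ, (δ (i - 1)).det (δ i) = 1

/-- The bi-infinite paths in `ℰ_R` which come from a path of length `n` between equivalent
vertices: there is a unit `c` with `vᵢ₊ₙ = c ^ ((-1) ^ i) • vᵢ` for all `i`. -/
def IsPathBetweenEquivalent {R : Type*} [CommRing R] (n : ℕ) (δ : ℤ → UnimodularPair R) : Prop :=
  IsBiinfinitePath δ ∧
    ∃ c : Rˣ, ∀ i : ℤ, δ (i + n) = (if Even i then c else c⁻¹) • δ i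

/-- The map from bi-infinite paths to tame SL₂-tilings: the path with vertices `(aᵢ, bᵢ)` is sent
to the tiling with entries `a_j b_i - b_j a_i`. -/
def pathTiling {R : Type*} [CommRing R] (δ : ℤ → UnimodularPair R) : ℤ → ℤ → R :=
  fun i j => (δ j).det (δ i)

/-- The path `γ = ⟨v₀, …, vₙ⟩` of length `n` in `ℱ_R` (between equivalent vertices) corresponds to
the tame semiregular frieze `F` of width `n`: it has a lift to `ℰ_R`, again a path of length `n`
between equivalent vertices, whose tiling is the extension of `F`. Two such lifts differ by a sign
and so have the same tiling. -/
def Corresponds {R : Type*} [CommRing R] (n : ℕ) (γ : List (FareyVertex R))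
    (F : ℤ → ℤ → R) : Prop :=
  ∃ δ : ℤ → UnimodularPair R, IsPathBetweenEquivalent n δ ∧
    γ = (List.range (n + 1)).map (fun k : ℕ => FareyVertex.mk (δ k)) ∧
    IsExtension n F (pathTiling δ)

/-! A tame semiregular frieze is the array of determinants `det (δ j) (δ i)` of a bi-infinite path
`δ` in `ℰ_R`, unique up to `SL₂(R)`: consecutive vertices satisfy
`δ (i + 1) = a i • δ i - δ (i - 1)`, where `a` is the third row of the frieze, and tameness makes the
rows of the frieze satisfy the same recurrence (`IsTameFrieze.recurrence`,
`IsTameFrieze.exists_path`). The zeros in the bottom row say that `δ` returns to an equivalent vertex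
after `n` steps. Over `ℤ` the only units are `±1`, so an integral lift of a frieze amounts to a closed
path in the Farey graph of `ℤ` which is mapped to the given path in `ℱ_N`.

The Farey graph of `ℤ` is simply connected: on a closed path starting at `p`, let `b` be a vertex at
which `|det p ·|` has a peak, with neighbours `a` and `c` on the path. The Plücker relation gives
`|det a c| ≤ 1`, so the path has a spur at `b` or can be deformed over the triangle `a, b, c`
(`exists_shortcut`). Applying a linear map to this contraction yields a contraction in `ℱ_N`
(`IsClosedIntPath.contracts`), and this proves one direction.

Conversely, a contraction in `ℱ_N` is reversed step by step over `ℤ`, starting with a lift of the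
base point: when a spur is inserted its edge is lifted with given initial vertex, and when a triangle
is inserted its third vertex is a combination with coefficients `±1` of the two vertices that are
already lifted (`ElementaryHomotopy.exists_lift`). The result is a closed path over `ℤ` above the
given one. After a choice of signs (`exists_signs`) it lifts `δ` itself on `0, …, n`, and its
quasi-periodic extension lifts all of `δ` (`exists_integral_path`). Its determinants form the
required frieze.

The reduction map is replaced throughout by `ofFrame u v`, which sends `(x, y)` to `x u + y v`. With
`u, v` the initial edge of `δ`, the base point lifts to `(1, 0)`, so that surjectivity of
`SL₂(ℤ) → SL₂(ℤ/N)` is not needed. -/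

/-! ### Unimodular pairs -/

namespace UnimodularPair

variable {R : Type*} [CommRing R]

/-- Adjacency up to sign: the two pairs represent adjacent vertices of `ℱ_R`. -/
def AdjUpToSign (p q : UnimodularPair R) : Prop :=
  p.det q = 1 ∨ p.det q = -1

@[simp] theorem smul_fst (c : Rˣ) (p : UnimodularPair R) : (c • p).fst = c * p.fst := rfl

@[simp] theorem smul_snd (c : Rˣ) (p : UnimodularPair R) : (c • p).snd = c * p.snd := rfl

theorem det_self (p : UnimodularPair R) : p.det p = 0 := by
  simp only [det]; ring

theorem det_swap (p q : UnimodularPair R) : p.det q = -q.det p := by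
  simp only [det]; ring

@[simp] theorem det_smul_left (c : Rˣ) (p q : UnimodularPair R) :
    (c • p).det q = c * p.det q := by
  simp only [det, smul_fst, smul_snd]; ring

@[simp] theorem det_smul_right (c : Rˣ) (p q : UnimodularPair R) :
    p.det (c • q) = c * p.det q := by
  simp only [det, smul_fst, smul_snd]; ring

/-- The relation between the six minors of a `2 × 4` matrix. -/
theorem plucker (p q r s : UnimodularPair R) :
    p.det q * r.det s - p.det r * q.det s + p.det s * q.det r = 0 := by
  simp only [det]; ring

theorem AdjUpToSign.symm {p q : UnimodularPair R} (h : p.AdjUpToSign q) : q.AdjUpToSign p := by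
  unfold AdjUpToSign at *
  rw [det_swap q p, neg_inj, neg_eq_iff_eq_neg]
  exact h.symm

theorem adjUpToSign_units_smul_left (ε : ℤˣ) {p q : UnimodularPair ℤ} :
    (ε • p).AdjUpToSign q ↔ p.AdjUpToSign q := by
  unfold AdjUpToSign
  rw [det_smul_left]
  rcases Int.units_eq_one_or ε with rfl | rfl
  · simp
  · simp [neg_eq_iff_eq_neg, or_comm]

/-- A pair is determined by its determinants with the two members of a frame. -/
theorem ext_of_det {p q u v : UnimodularPair R} (h : u.det v = 1) (hu : u.det p = u.det q)
    (hv : p.det v = q.det v) : p = q := by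
  simp only [det] at *
  ext
  · linear_combination (q.fst - p.fst) * h + u.fst * hv + v.fst * hu
  · linear_combination (q.snd - p.snd) * h + u.snd * hv + v.snd * hu

theorem exists_det_eq_one (p : UnimodularPair R) : ∃ q : UnimodularPair R, p.det q = 1 := by
  obtain ⟨x, y, h⟩ := p.coprime
  exact ⟨⟨-y, x, -p.snd, p.fst, by linear_combination h⟩, by simp only [det]; linear_combination h⟩

theorem smul_eq_smul_iff {c d : Rˣ} {p : UnimodularPair R} : c • p = d • p ↔ c = d := by
  refine ⟨fun h => ?_, fun h => h ▸ rfl⟩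
  obtain ⟨q, hq⟩ := p.exists_det_eq_one
  have := congrArg (fun r => r.det q) h
  ext
  simpa [hq] using this

/-- Pairs with vanishing determinant differ by a unit. -/
theorem exists_units_smul_eq_of_det_eq_zero {p q : UnimodularPair R} (h : p.det q = 0) :
    ∃ c : Rˣ, c • p = q := by
  obtain ⟨x, y, hp⟩ := p.coprime
  obtain ⟨z, w, hq⟩ := q.coprime
  simp only [det] at h
  have h1 : (x * q.fst + y * q.snd) * (z * p.fst + w * p.snd) = 1 := by
    linear_combination (x * w - y * z) * -h + hp * (z * q.fst + w * q.snd) + hq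
  refine ⟨⟨_, _, h1, by rw [mul_comm, h1]⟩, ?_⟩
  ext
  · simp only [smul_fst]; linear_combination q.fst * hp + y * h
  · simp only [smul_snd]; linear_combination q.snd * hp - x * h

theorem det_eq_zero_or_of_int {p q : UnimodularPair ℤ} (h : p.det q = 0) :
    q = p ∨ q = (-1 : ℤˣ) • p := by
  obtain ⟨c, rfl⟩ := exists_units_smul_eq_of_det_eq_zero h
  rcases Int.units_eq_one_or c with rfl | rfl <;> simp

/-- The image of an integer pair `(x, y)` under the linear map which sends the standard basis to
the frame `u, v`, namely `x u + y v`. -/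
def ofFrame (u v : UnimodularPair R) (h : u.det v = 1) (p : UnimodularPair ℤ) :
    UnimodularPair R where
  fst := p.fst * u.fst + p.snd * v.fst
  snd := p.fst * u.snd + p.snd * v.snd
  coprime := by
    obtain ⟨x, y, hxy⟩ := p.coprime
    replace hxy := congrArg (Int.cast : ℤ → R) hxy
    push_cast at hxy
    simp only [det] at h
    refine ⟨x * v.snd - y * u.snd, y * u.fst - x * v.fst, ?_⟩
    linear_combination (u.fst * v.snd - u.snd * v.fst) * hxy + h

section Frame

variable {u v : UnimodularPair R} (h : u.det v = 1)

theorem det_ofFrame (p q : UnimodularPair ℤ) :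
    (ofFrame u v h p).det (ofFrame u v h q) = (p.det q : ℤ) := by
  have h' := h
  simp only [det, ofFrame] at h' ⊢
  push_cast
  linear_combination (p.fst * q.snd - p.snd * q.fst : R) * h'

theorem AdjUpToSign.ofFrame {p q : UnimodularPair ℤ} (hpq : p.AdjUpToSign q) :
    (ofFrame u v h p).AdjUpToSign (ofFrame u v h q) := by
  unfold AdjUpToSign at *
  rw [det_ofFrame]
  rcases hpq with h1 | h1 <;> simp [h1]

theorem ofFrame_units_smul (ε : ℤˣ) (p : UnimodularPair ℤ) :
    ofFrame u v h (ε • p) = (Units.map (Int.castRingHom R).toMonoidHom ε) • ofFrame u v h p := by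
  ext <;> simp [ofFrame] <;> ring

/-- A pair whose determinants with the images of `p` and `q` are the residues of coprime integers
is itself the image of an integer pair with these determinants. -/
theorem exists_ofFrame_eq {p q : UnimodularPair ℤ} (hpq : p.det q = 1) {r : UnimodularPair R}
    {x y : ℤ} (hxy : IsCoprime x y) (hx : r.det (ofFrame u v h q) = x)
    (hy : (ofFrame u v h p).det r = y) :
    ∃ s, ofFrame u v h s = r ∧ s.det q = x ∧ p.det s = y := by
  let s := ofFrame p q hpq ⟨x, y, hxy⟩
  have h1 : s.det q = x := by
    have hpq' := hpq
    simp only [det, s, ofFrame, Int.cast_id] at hpq' ⊢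
    linear_combination x * hpq'
  have h2 : p.det s = y := by
    have hpq' := hpq
    simp only [det, s, ofFrame, Int.cast_id] at hpq' ⊢
    linear_combination y * hpq'
  have hpq' : (ofFrame u v h p).det (ofFrame u v h q) = 1 := by
    rw [det_ofFrame, hpq, Int.cast_one]
  refine ⟨s, ext_of_det hpq' ?_ ?_, h1, h2⟩
  · rw [det_ofFrame, h2, hy]
  · rw [det_ofFrame, h1, hx]

end Frame

end UnimodularPair

open UnimodularPair

/-! ### Vertices and edges of the Farey complex -/

section Vertices

variable {R : Type*} [CommRing R]

theorem FareyVertex.mk_eq_mk_iff {p q : UnimodularPair R} :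
    FareyVertex.mk p = FareyVertex.mk q ↔ q = p ∨ q = (-1 : Rˣ) • p := by
  rw [eq_comm]
  unfold FareyVertex.mk
  rw [Quotient.eq, MulAction.orbitRel_apply, MulAction.mem_orbit_iff]
  constructor
  · rintro ⟨⟨c, rfl | rfl⟩, rfl⟩
    · exact Or.inl (one_smul _ p)
    · exact Or.inr rfl
  · rintro (rfl | rfl)
    · exact ⟨1, one_smul _ _⟩
    · exact ⟨⟨-1, Or.inr rfl⟩, rfl⟩

theorem fareyAdj_mk_iff {p q : UnimodularPair R} :
    FareyAdj (FareyVertex.mk p) (FareyVertex.mk q) ↔ p.AdjUpToSign q := by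
  constructor
  · rintro ⟨p', q', hp, hq, h⟩
    unfold AdjUpToSign
    rcases FareyVertex.mk_eq_mk_iff.1 hp with rfl | rfl <;>
      rcases FareyVertex.mk_eq_mk_iff.1 hq with rfl | rfl <;>
      simpa [neg_eq_iff_eq_neg, or_comm] using h
  · exact fun h => ⟨p, q, rfl, rfl, h⟩

variable {u v : UnimodularPair R} (h : u.det v = 1)

/-- The map from integer pairs to `ℱ_R` given by a frame over `R`; for the standard frame this is
the covering map `ℱ_ℤ → ℱ_R`. -/
def frameVertex (u v : UnimodularPair R) (h : u.det v = 1) (p : UnimodularPair ℤ) :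
    FareyVertex R :=
  FareyVertex.mk (ofFrame u v h p)

theorem fareyAdj_frameVertex {p q : UnimodularPair ℤ} (hpq : p.AdjUpToSign q) :
    FareyAdj (frameVertex u v h p) (frameVertex u v h q) :=
  fareyAdj_mk_iff.2 (hpq.ofFrame h)

theorem frameVertex_eq_of_det_eq_zero {p q : UnimodularPair ℤ} (hpq : p.det q = 0) :
    frameVertex u v h p = frameVertex u v h q := by
  rcases det_eq_zero_or_of_int hpq with rfl | rfl
  · rfl
  · unfold frameVertex
    rw [FareyVertex.mk_eq_mk_iff, ofFrame_units_smul]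
    right
    congr 1
    ext
    simp

end Vertices

/-! ### Bi-infinite paths and friezes -/

/-- A two-sided second-order linear recurrence has a solution with prescribed values at `0`
and `1`. -/
theorem exists_int_recurrence {R : Type*} [CommRing R] (a : ℤ → R) (x₀ x₁ : R) :
    ∃ x : ℤ → R, x 0 = x₀ ∧ x 1 = x₁ ∧ ∀ i, x (i + 1) = a i * x i - x (i - 1) := by
  let fwd : ℕ → R × R := fun k =>
    Nat.rec (x₀, x₁) (fun k s => (s.2, a (k + 1) * s.2 - s.1)) k
  let bwd : ℕ → R × R := fun k =>
    Nat.rec (x₁, x₀) (fun k s => (s.2, a (-k) * s.2 - s.1)) k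
  have hb : ∀ k : ℕ, (bwd (k + 2)).1 = a (-k) * (bwd (k + 1)).1 - (bwd k).1 := fun k => rfl
  have hf : ∀ k : ℕ, (fwd (k + 2)).1 = a (k + 1) * (fwd (k + 1)).1 - (fwd k).1 := fun k => rfl
  -- On the nonnegative half `x k = fwd k`, and on the negative half `x (-(k + 1)) = bwd (k + 2)`.
  refine ⟨fun i => match i with
    | Int.ofNat k => (fwd k).1
    | Int.negSucc k => (bwd (k + 2)).1, rfl, rfl, fun i => ?_⟩
  obtain ⟨k, rfl | rfl⟩ : ∃ k : ℕ, i = (k : ℤ) + 1 ∨ i = -(k : ℤ) := by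
    rcases le_or_gt i 0 with h | h
    · exact ⟨i.natAbs, Or.inr (by omega)⟩
    · exact ⟨(i - 1).natAbs, Or.inl (by omega)⟩
  · have e1 : (k : ℤ) + 1 + 1 = Int.ofNat (k + 2) := by simp; ring
    have e2 : (k : ℤ) + 1 = Int.ofNat (k + 1) := by simp
    have e3 : (k : ℤ) + 1 - 1 = Int.ofNat k := by simp
    rw [e1, e3]
    simp only [e2]
    rw [hf k, ← e2]
  · match k with
    | 0 =>
      show x₁ = a 0 * x₀ - (a 0 * x₀ - x₁)
      ring
    | 1 =>
      show x₀ = a (-1) * (a 0 * x₀ - x₁) - (a (-1) * (a 0 * x₀ - x₁) - x₀)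
      ring
    | k + 2 =>
      have e1 : -((k + 2 : ℕ) : ℤ) + 1 = Int.negSucc k := by rw [Int.negSucc_eq]; push_cast; ring
      have e2 : -((k + 2 : ℕ) : ℤ) = Int.negSucc (k + 1) := by
        rw [Int.negSucc_eq]; push_cast; ring
      have e3 : -((k + 2 : ℕ) : ℤ) - 1 = Int.negSucc (k + 2) := by
        rw [Int.negSucc_eq]; push_cast; ring
      have := hb (k + 2)
      rw [e1, e3]
      simp only [e2]
      rw [show k + 2 + 2 = k + 4 from rfl] at *
      rw [this, ← e2]
      show (bwd (k + 2)).1 = a _ * (bwd (k + 3)).1 - (a _ * (bwd (k + 3)).1 - (bwd (k + 2)).1)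
      ring

section Paths

variable {R : Type*} [CommRing R]

/-- The path in `ℰ_R` with prescribed coefficients `a i` which starts with the edge from `(1, 0)`
to `(0, 1)`. -/
theorem exists_biinfinitePath (a : ℤ → R) : ∃ δ : ℤ → UnimodularPair R,
    IsBiinfinitePath δ ∧ δ 0 = ⟨1, 0, isCoprime_one_left⟩ ∧ δ 1 = ⟨0, 1, isCoprime_one_right⟩ ∧
      ∀ i, (δ (i - 1)).det (δ (i + 1)) = a i := by
  obtain ⟨x, x0, x1, hx⟩ := exists_int_recurrence a 1 0
  obtain ⟨y, y0, y1, hy⟩ := exists_int_recurrence a 0 1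
  have key : ∀ i : ℤ, x i * y (i + 1) - y i * x (i + 1) = 1 := by
    intro i
    induction i using Int.induction_on with
    | zero => simp [x0, x1, y0, y1]
    | succ k ih =>
      rw [hx (k + 1), hy (k + 1), add_sub_cancel_right]
      linear_combination ih
    | pred k ih =>
      rw [sub_add_cancel]
      rw [hx, hy] at ih
      linear_combination ih
  refine ⟨fun i => ⟨x i, y i, y (i + 1), -x (i + 1), by linear_combination key i⟩, fun i => ?_,
    UnimodularPair.ext x0 y0, UnimodularPair.ext x1 y1, fun i => ?_⟩
  · have := key (i - 1)
    rw [sub_add_cancel] at this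
    exact this
  · have := key (i - 1)
    rw [sub_add_cancel] at this
    simp only [det, hx i, hy i]
    linear_combination a i * this

/-- Consecutive vertices of a path satisfy a second-order recurrence; this is that recurrence for
determinants with a fixed pair. -/
theorem IsBiinfinitePath.det_succ {δ : ℤ → UnimodularPair R} (hδ : IsBiinfinitePath δ)
    (p : UnimodularPair R) (i : ℤ) : p.det (δ (i + 1)) =
      (δ (i - 1)).det (δ (i + 1)) * p.det (δ i) - p.det (δ (i - 1)) := by
  have h1 := hδ i
  have h2 := hδ (i + 1)
  rw [add_sub_cancel_right] at h2
  have := plucker p (δ (i - 1)) (δ i) (δ (i + 1))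
  rw [h1, h2] at this
  linear_combination this

theorem pathTiling_isTameTiling {δ : ℤ → UnimodularPair R} (hδ : IsBiinfinitePath δ) :
    IsTameTiling (pathTiling δ) where
  sl2 i j := by
    have h1 := hδ (i + 1)
    have h2 := hδ (j + 1)
    rw [add_sub_cancel_right] at h1 h2
    simp only [pathTiling, det] at *
    linear_combination h2 + h1 * ((δ j).fst * (δ (j + 1)).snd - (δ j).snd * (δ (j + 1)).fst)
  tame i j := by
    simp only [blockDet, Matrix.det_fin_three, pathTiling, det, Matrix.of_apply, Matrix.cons_val]
    ring

/-- In a tame semiregular frieze, each row is obtained from the two rows above it with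
coefficients taken from the third row. -/
theorem IsTameFrieze.recurrence {n : ℕ} {G : ℤ → ℤ → R} (hG : IsTameFrieze n G)
    (hs : IsSemiregular G) (j : ℤ) (k : ℕ) (hk : k + 2 ≤ n) :
    G (j + (k + 2)) j =
      G (j + (k + 2)) (j + k) * G (j + (k + 1)) j - G (j + k) j := by
  induction k using Nat.strong_induction_on generalizing j with
  | _ k ih =>
    match k with
    | 0 =>
      have h0 := hG.top_zero j
      have h1 := hs j
      simp [h0, h1]
    | 1 =>
      have h := hG.diamond (j + 2) j (by omega) (by omega)
      have h1 := hs j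
      have h2 := hs (j + 1)
      rw [show j + 1 + 1 = j + 2 by ring] at h2
      rw [show j + 2 + 1 = j + 3 by ring, h2] at h
      push_cast
      rw [h1]
      linear_combination -h
    | k + 2 =>
      -- Subtracting from the last row of the block the combination of the other two rows given
      -- by the recurrence leaves one nonzero entry, whose cofactor is `1` by the diamond rule.
      have e1 := ih (k + 1) (by omega) (j + 1) (by omega)
      have e2 := ih k (by omega) (j + 2) (by omega)
      have hd := hG.diamond (j + k + 2) (j + 1) (by omega) (by omega)
      have ht := hG.tame (j + k + 3) (j + 1) (by omega) (by omega)
      simp only [blockDet, Matrix.det_fin_three, Matrix.of_apply, Matrix.cons_val] at ht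
      push_cast at *
      rw [show j + k + 3 - 1 = j + k + 2 by ring, show j + k + 3 + 1 = j + k + 4 by ring,
        show j + 1 - 1 = j by ring, show j + 1 + 1 = j + 2 by ring] at ht
      rw [show j + k + 2 + 1 = j + k + 3 by ring, show j + 1 + 1 = j + 2 by ring] at hd
      rw [show j + 1 + ((k : ℤ) + 1 + 2) = j + k + 4 by ring,
        show j + 1 + ((k : ℤ) + 1 + 1) = j + k + 3 by ring,
        show j + 1 + ((k : ℤ) + 1) = j + k + 2 by ring] at e1
      rw [show j + 2 + ((k : ℤ) + 2) = j + k + 4 by ring,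
        show j + 2 + ((k : ℤ) + 1) = j + k + 3 by ring,
        show j + 2 + (k : ℤ) = j + k + 2 by ring] at e2
      rw [show j + ((k : ℤ) + 2 + 2) = j + k + 4 by ring,
        show j + ((k : ℤ) + 2 + 1) = j + k + 3 by ring,
        show j + ((k : ℤ) + 2) = j + k + 2 by ring]
      rw [e1, e2] at ht
      linear_combination ht - (G (j + k + 4) j -
        G (j + k + 4) (j + k + 2) * G (j + k + 3) j + G (j + k + 2) j) * hd

/-- A path whose coefficients are the entries of the third row of a tame semiregular frieze
produces the whole frieze. -/
theorem IsTameFrieze.det_path_eq {n : ℕ} {G : ℤ → ℤ → R} (hG : IsTameFrieze n G)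
    (hs : IsSemiregular G) {δ : ℤ → UnimodularPair R} (hδ : IsBiinfinitePath δ)
    (ha : ∀ i, (δ (i - 1)).det (δ (i + 1)) = G (i + 1) (i - 1)) (j : ℤ) (k : ℕ) (hk : k ≤ n) :
    (δ j).det (δ (j + k)) = G (j + k) j := by
  induction k using Nat.twoStepInduction with
  | zero => simp [det_self, hG.top_zero]
  | one =>
    have := hδ (j + 1)
    rw [add_sub_cancel_right] at this
    simp [this, hs j]
  | more k h0 h1 =>
    have hrec := hG.recurrence hs j k hk
    have hstep := hδ.det_succ (δ j) (j + k + 1)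
    rw [ha, add_sub_cancel_right, show j + k + 1 + 1 = j + (k + 2) by ring] at hstep
    have h1' := h1 (by omega)
    push_cast at *
    rw [show j + k + 1 = j + (k + 1) by ring, h1', h0 (by omega)] at hstep
    rw [hstep, hrec]

/-- Every tame semiregular frieze comes from a path in `ℰ_R`, which can be chosen to start with
the edge from `(1, 0)` to `(0, 1)`. -/
theorem IsTameFrieze.exists_path {n : ℕ} {G : ℤ → ℤ → R} (hG : IsTameFrieze n G)
    (hs : IsSemiregular G) : ∃ δ : ℤ → UnimodularPair R, IsBiinfinitePath δ ∧
      δ 0 = ⟨1, 0, isCoprime_one_left⟩ ∧ δ 1 = ⟨0, 1, isCoprime_one_right⟩ ∧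
        ∀ i j : ℤ, 0 ≤ i - j → i - j ≤ n → pathTiling δ i j = G i j := by
  obtain ⟨δ, hδ, h0, h1, ha⟩ := exists_biinfinitePath fun i => G (i + 1) (i - 1)
  refine ⟨δ, hδ, h0, h1, fun i j h h' => ?_⟩
  have := hG.det_path_eq hs hδ ha j (i - j).toNat (by omega)
  rwa [show j + ((i - j).toNat : ℤ) = i by omega] at this

/-- A path whose tiling has zeros at distance `n` is a path between equivalent vertices. -/
theorem IsBiinfinitePath.isPathBetweenEquivalent {n : ℕ} {δ : ℤ → UnimodularPair R}
    (hδ : IsBiinfinitePath δ) (h : ∀ i, (δ i).det (δ (i + n)) = 0) :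
    IsPathBetweenEquivalent n δ := by
  choose c hc using fun i => exists_units_smul_eq_of_det_eq_zero (h i)
  have step : ∀ i, c (i + 1) = (c i)⁻¹ := by
    intro i
    have h1 := hδ (i + n + 1)
    have h2 := hδ (i + 1)
    rw [add_sub_cancel_right] at h1 h2
    rw [show i + n + 1 = i + 1 + n by ring, ← hc i, ← hc (i + 1)] at h1
    rw [eq_inv_iff_mul_eq_one]
    ext
    simpa [h2] using h1
  refine ⟨hδ, c 0, fun i => ?_⟩
  rw [← hc i]
  congr 1
  induction i using Int.induction_on with
  | zero => simp
  | succ k ih =>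
    rw [step, ih, if_congr Int.even_add_one rfl rfl]
    by_cases hk : Even (k : ℤ)
    · rw [if_pos hk, if_neg (not_not.2 hk)]
    · rw [if_neg hk, if_pos hk, inv_inv]
  | pred k ih =>
    have := step (-k - 1)
    rw [sub_add_cancel, ih] at this
    rw [← inv_inj, ← this]
    have hpar := Int.even_add_one (n := -k - 1)
    rw [sub_add_cancel] at hpar
    rw [if_congr hpar rfl rfl]
    by_cases hk : Even (-(k : ℤ) - 1) <;> simp [hk]

/-- The tiling of a path which returns to an equivalent vertex after `n` steps contains a tame
frieze of width `n`. -/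
theorem pathTiling_isTameFrieze {n : ℕ} {δ : ℤ → UnimodularPair R} (hδ : IsBiinfinitePath δ)
    (h : ∀ i, (δ i).det (δ (i + n)) = 0) : IsTameFrieze n (pathTiling δ) where
  top_zero i := det_self _
  bottom_zero i := by rw [add_comm]; exact h i
  diamond i j _ _ := (pathTiling_isTameTiling hδ).sl2 i j
  tame i j _ _ := (pathTiling_isTameTiling hδ).tame i j

end Paths

/-- Over `ℤ` the second row of a tame frieze is constant and equal to `1` or `-1`; multiplying the
frieze by this constant makes it semiregular. -/
theorem IsTameFrieze.normalize {n : ℕ} (hn : 2 ≤ n) {G : ℤ → ℤ → ℤ} (hG : IsTameFrieze n G) :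
    IsTameFrieze n (fun i j => G 1 0 * G i j) ∧ IsSemiregular (fun i j => G 1 0 * G i j) := by
  have hstep : ∀ i : ℤ, G (i + 1) i * G (i + 1 + 1) (i + 1) = 1 := fun i => by
    have := hG.diamond (i + 1) i (by omega) (by omega)
    rwa [hG.top_zero, zero_mul, sub_zero] at this
  have hsq : ∀ i : ℤ, G (i + 1) i * G (i + 1) i = 1 := fun i => by
    rcases Int.eq_one_or_neg_one_of_mul_eq_one (hstep i) with h | h <;> rw [h] <;> rfl
  have hconst : ∀ i : ℤ, G (i + 1 + 1) (i + 1) = G (i + 1) i := fun i => by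
    linear_combination G (i + 1) i * hstep i - G (i + 1 + 1) (i + 1) * hsq i
  have h0 : G 1 0 * G 1 0 = 1 := hsq 0
  refine ⟨⟨⟨fun i => by simp [hG.top_zero], fun i => by simp [hG.bottom_zero],
    fun i j h h' => ?_⟩, fun i j h h' => ?_⟩, fun i => ?_⟩
  · linear_combination hG.diamond i j h h' + (G i j * G (i + 1) (j + 1) -
      G i (j + 1) * G (i + 1) j) * h0
  · have := hG.tame i j h h'
    simp only [blockDet, Matrix.det_fin_three, Matrix.of_apply, Matrix.cons_val] at *
    linear_combination G 1 0 ^ 3 * this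
  · induction i using Int.induction_on with
    | zero => exact h0
    | succ k ih => simpa only [hconst] using ih
    | pred k ih =>
      have := hconst (-k - 1)
      simp only [sub_add_cancel] at this ⊢
      rw [← this]
      exact ih

/-! ### Closed paths in the Farey graph of the integers contract -/

section Lists

variable {α : Type*}

/-- If a function on a list starts with an ascent and is zero at the end, then it has a local
maximum right after an ascent. -/
theorem List.exists_peak (h : α → ℕ) (l : List α) (a b : α) (hab : h a < h b)
    (hlast : ∀ x ∈ (a :: b :: l).getLast?, h x = 0) :
    ∃ l₁ u v w l₂, a :: b :: l = l₁ ++ u :: v :: w :: l₂ ∧ h u < h v ∧ h w ≤ h v := by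
  induction l generalizing a b with
  | nil =>
    have := hlast b (by simp)
    omega
  | cons c l ih =>
    rcases le_or_gt (h c) (h b) with hc | hc
    · exact ⟨[], a, b, c, l, rfl, hab, hc⟩
    · obtain ⟨l₁, u, v, w, l₂, hl, h1, h2⟩ := ih b c hc (by simpa using hlast)
      exact ⟨a :: l₁, u, v, w, l₂, by rw [hl]; rfl, h1, h2⟩

end Lists

/-- A list of integer pairs represents a closed path in the Farey graph of `ℤ`. The pairs stand for
vertices up to sign, so the initial and the final pair are only required to be proportional. -/
structure IsClosedIntPath (L : List (UnimodularPair ℤ)) : Prop where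
  ne_nil : L ≠ []
  chain : L.IsChain AdjUpToSign
  closed : ∀ p ∈ L.head?, ∀ q ∈ L.getLast?, p.det q = 0

section Contraction

variable {R : Type*} [CommRing R] {u v : UnimodularPair R} (h : u.det v = 1)

/-- A closed path of positive length in the Farey graph of `ℤ` has a peak `b`, with respect to the
distance `|det p ·|` from its initial vertex `p`, at which it can be shortened by an elementary
homotopy. -/
theorem exists_shortcut {p q : UnimodularPair ℤ} {l : List (UnimodularPair ℤ)}
    (hL : IsClosedIntPath (p :: q :: l)) :
    ∃ l₁ a b c l₂, p :: q :: l = l₁ ++ a :: b :: c :: l₂ ∧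
      (a.det c = 0 ∨ a.AdjUpToSign c) := by
  have hpq : p.AdjUpToSign q := (List.isChain_cons_cons.1 hL.chain).1
  obtain ⟨l₁, a, b, c, l₂, hl, hab, hcb⟩ := List.exists_peak (fun x => (p.det x).natAbs) l p q
    (by rcases hpq with h | h <;> simp [h, det_self])
    (fun x hx => by simpa using hL.closed p (by simp) x hx)
  refine ⟨l₁, a, b, c, l₂, hl, ?_⟩
  have hch := hL.chain
  rw [hl, List.isChain_append_cons_cons, List.isChain_cons_cons] at hch
  obtain ⟨-, h1, h2, -⟩ := hch
  -- Since `det a b` and `det b c` are signs, `det a c * det p b` is `± det p a ± det p c`, which is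
  -- smaller than `2 |det p b|` because `b` is a peak; hence `|det a c| ≤ 1`.
  have hpl := plucker p a b c
  have hlt : (a.det c).natAbs * (p.det b).natAbs < 2 * (p.det b).natAbs := by
    rw [← Int.natAbs_mul]
    unfold AdjUpToSign at h1 h2
    have : p.det b * a.det c = p.det a * b.det c + p.det c * a.det b := by
      linear_combination -hpl
    rw [mul_comm, this]
    rcases h1 with h1 | h1 <;> rcases h2 with h2 | h2 <;> rw [h1, h2] <;> omega
  have := lt_of_mul_lt_mul_right hlt (Nat.zero_le _)
  unfold AdjUpToSign
  omega

/-- The image in `ℱ_R` of a closed path in the Farey graph of `ℤ` is contractible. -/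
theorem IsClosedIntPath.contracts {L : List (UnimodularPair ℤ)} (hL : IsClosedIntPath L) :
    ∃ x, Relation.ReflTransGen ElementaryHomotopy (L.map (frameVertex u v h)) [x] := by
  induction hlen : L.length using Nat.strong_induction_on generalizing L with
  | _ k ih =>
    match L, hL with
    | [], hL => exact absurd rfl hL.ne_nil
    | [p], _ => exact ⟨_, .refl⟩
    | p :: q :: l, hL =>
      obtain ⟨l₁, a, b, c, l₂, hl, hac⟩ := exists_shortcut hL
      rw [hl] at hL hlen ⊢
      have hch := hL.chain
      rw [List.isChain_append_cons_cons, List.isChain_cons_cons] at hch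
      obtain ⟨h0, h1, h2, h3⟩ := hch
      rcases hac with hac | hac
      · -- The vertices `a` and `c` coincide, and the spur at `b` is removed.
        have hclosed : IsClosedIntPath (l₁ ++ a :: l₂) := by
          refine ⟨by simp, List.isChain_split.2 ⟨h0, ?_⟩, ?_⟩
          · rcases det_eq_zero_or_of_int hac with rfl | rfl
            · exact h3
            · match l₂, h3 with
              | [], _ => simp
              | d :: l₂, h3 =>
                rw [List.isChain_cons_cons, adjUpToSign_units_smul_left] at h3
                exact List.isChain_cons_cons.2 h3
          · intro x hx y hy
            have hx' : x ∈ (l₁ ++ a :: b :: c :: l₂).head? := by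
              cases l₁ <;> simpa using hx
            match l₂ with
            | [] =>
              have := hL.closed x hx' c (by simp)
              obtain rfl : a = y := by simpa using hy
              rcases det_eq_zero_or_of_int hac with rfl | rfl
              · exact this
              · simpa using this
            | d :: l₂ => exact hL.closed x hx' y (by simpa [List.getLast?_append] using hy)
        obtain ⟨x, hx⟩ := ih _ (by rw [← hlen]; simp) hclosed rfl
        refine ⟨x, .head ?_ hx⟩
        have := ElementaryHomotopy.spur (l₁.map (frameVertex u v h)) (l₂.map (frameVertex u v h))
          (frameVertex u v h b) (frameVertex u v h a)
        simpa [← frameVertex_eq_of_det_eq_zero h hac] using this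
      · -- The vertices `a`, `b`, `c` form a triangle.
        have hclosed : IsClosedIntPath (l₁ ++ a :: c :: l₂) := by
          refine ⟨by simp, List.isChain_append_cons_cons.2 ⟨h0, hac, h3⟩, fun x hx y hy => ?_⟩
          refine hL.closed x (by cases l₁ <;> simpa using hx) y ?_
          simpa [List.getLast?_append] using hy
        obtain ⟨x, hx⟩ := ih _ (by rw [← hlen]; simp) hclosed rfl
        refine ⟨x, .head ?_ hx⟩
        have := ElementaryHomotopy.triangle (l₁.map (frameVertex u v h))
          (l₂.map (frameVertex u v h)) _ _ _ (fareyAdj_frameVertex h h1)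
          (fareyAdj_frameVertex h h2) (fareyAdj_frameVertex h hac)
        simpa using this

end Contraction

/-! ### Contractible paths modulo `N` lift to closed integer paths -/

section HomotopyInvariants

variable {R : Type*} [CommRing R]

theorem ElementaryHomotopy.head?_eq {γ γ' : List (FareyVertex R)} (h : ElementaryHomotopy γ γ') :
    γ.head? = γ'.head? := by
  cases h with
  | spur l₁ l₂ x y => cases l₁ <;> simp
  | triangle l₁ l₂ x y z => cases l₁ <;> simp

theorem ElementaryHomotopy.isChain {γ γ' : List (FareyVertex R)} (h : ElementaryHomotopy γ γ')
    (hγ : γ.IsChain FareyAdj) : γ'.IsChain FareyAdj := by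
  cases h with
  | spur l₁ l₂ x y =>
    simp only [List.append_assoc, List.cons_append, List.nil_append] at hγ ⊢
    rw [List.isChain_append_cons_cons, List.isChain_cons_cons] at hγ
    exact List.isChain_split.2 ⟨hγ.1, hγ.2.2.2⟩
  | triangle l₁ l₂ x y z _ _ hxz =>
    simp only [List.append_assoc, List.cons_append, List.nil_append] at hγ ⊢
    rw [List.isChain_append_cons_cons, List.isChain_cons_cons] at hγ
    exact List.isChain_append_cons_cons.2 ⟨hγ.1, hxz, hγ.2.2.2⟩

end HomotopyInvariants

section Lifting

variable {N : ℕ} {u v : UnimodularPair (ZMod N)} (h : u.det v = 1)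

/-- Edges lift: an edge of `ℱ_N` can be lifted to `ℤ` with a prescribed initial vertex. -/
theorem exists_lift_of_fareyAdj (p : UnimodularPair ℤ) {x : FareyVertex (ZMod N)}
    (hx : FareyAdj (frameVertex u v h p) x) :
    ∃ q, frameVertex u v h q = x ∧ p.AdjUpToSign q := by
  obtain ⟨r, rfl⟩ : ∃ r, FareyVertex.mk r = x := Quotient.exists_rep x
  rw [frameVertex, fareyAdj_mk_iff] at hx
  obtain ⟨w, hw⟩ := p.exists_det_eq_one
  obtain ⟨a, ha⟩ := ZMod.intCast_surjective (r.det (ofFrame u v h w))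
  rcases hx with hx | hx
  · obtain ⟨s, rfl, -, hs⟩ := exists_ofFrame_eq h hw (x := a) isCoprime_one_right ha.symm
      (by simpa using hx)
    exact ⟨s, rfl, .inl hs⟩
  · obtain ⟨s, rfl, -, hs⟩ := exists_ofFrame_eq h hw (x := a) isCoprime_one_right.neg_right
      ha.symm (by simpa using hx)
    exact ⟨s, rfl, .inr hs⟩

/-- Triangles lift: a triangle of `ℱ_N` can be lifted to `ℤ` with one side prescribed. -/
theorem exists_lift_of_triangle {p q : UnimodularPair ℤ} (hpq : p.AdjUpToSign q)
    {x : FareyVertex (ZMod N)} (hpx : FareyAdj (frameVertex u v h p) x)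
    (hxq : FareyAdj x (frameVertex u v h q)) :
    ∃ s, frameVertex u v h s = x ∧ p.AdjUpToSign s ∧ s.AdjUpToSign q := by
  wlog hdet : p.det q = 1 generalizing q
  · -- Change the sign of `q`.
    have hneg : p.det q = -1 := hpq.resolve_left hdet
    have hq : ((-1 : ℤˣ) • q).det q = 0 := by simp [det_self]
    obtain ⟨s, hs, hps, hsq⟩ := this (q := (-1 : ℤˣ) • q) (.inl (by simp [hneg]))
      (by rwa [frameVertex_eq_of_det_eq_zero h hq]) (by simp [hneg])
    exact ⟨s, hs, hps, ((adjUpToSign_units_smul_left _).1 hsq.symm).symm⟩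
  obtain ⟨r, rfl⟩ : ∃ r, FareyVertex.mk r = x := Quotient.exists_rep x
  rw [frameVertex, fareyAdj_mk_iff] at hpx hxq
  have hsign : ∀ {z : ZMod N}, z = 1 ∨ z = -1 → ∃ a : ℤ, (a = 1 ∨ a = -1) ∧ z = a := by
    rintro z (rfl | rfl)
    · exact ⟨1, by simp⟩
    · exact ⟨-1, by simp⟩
  obtain ⟨a, ha, hra⟩ := hsign hxq
  obtain ⟨b, hb, hrb⟩ := hsign hpx
  have hab : IsCoprime a b := by
    rcases ha with rfl | rfl
    · exact isCoprime_one_left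
    · exact isCoprime_one_left.neg_left
  obtain ⟨s, rfl, hs, hs'⟩ := exists_ofFrame_eq h hdet hab hra hrb
  exact ⟨s, rfl, by rwa [AdjUpToSign, hs'], by rwa [AdjUpToSign, hs]⟩

/-- An elementary homotopy between paths in `ℱ_N` can be lifted to `ℤ` backwards. -/
theorem ElementaryHomotopy.exists_lift {γ : List (FareyVertex (ZMod N))}
    {L' : List (UnimodularPair ℤ)} (hγ : γ.IsChain FareyAdj)
    (hom : ElementaryHomotopy γ (L'.map (frameVertex u v h))) (hL' : IsClosedIntPath L') :
    ∃ L, L.map (frameVertex u v h) = γ ∧ IsClosedIntPath L := by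
  generalize hγ' : L'.map (frameVertex u v h) = γ' at hom
  cases hom with
  | spur l₁ l₂ x y =>
    simp only [List.append_assoc, List.cons_append, List.nil_append] at hγ hγ' ⊢
    obtain ⟨L₁, M, rfl, rfl, hM⟩ := List.map_eq_append_iff.1 hγ'
    obtain ⟨p, L₂, rfl, rfl, rfl⟩ := List.map_eq_cons_iff.1 hM
    rw [List.isChain_append_cons_cons] at hγ
    obtain ⟨q, rfl, hpq⟩ := exists_lift_of_fareyAdj h p hγ.2.1
    have hch := List.isChain_split.1 hL'.chain
    refine ⟨L₁ ++ p :: q :: p :: L₂, by simp, by simp, ?_, fun x hx y hy => ?_⟩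
    · rw [List.isChain_append_cons_cons, List.isChain_cons_cons]
      exact ⟨hch.1, hpq, hpq.symm, hch.2⟩
    · refine hL'.closed x (by cases L₁ <;> simpa using hx) y ?_
      simpa [List.getLast?_append] using hy
  | triangle l₁ l₂ x y z hxy hyz hxz =>
    simp only [List.append_assoc, List.cons_append, List.nil_append] at hγ hγ' ⊢
    obtain ⟨L₁, M, rfl, rfl, hM⟩ := List.map_eq_append_iff.1 hγ'
    obtain ⟨p, M', rfl, rfl, hM'⟩ := List.map_eq_cons_iff.1 hM
    obtain ⟨q, L₂, rfl, rfl, rfl⟩ := List.map_eq_cons_iff.1 hM'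
    have hch := List.isChain_append_cons_cons.1 hL'.chain
    obtain ⟨s, rfl, hps, hsq⟩ := exists_lift_of_triangle h hch.2.1 hxy hyz
    refine ⟨L₁ ++ p :: s :: q :: L₂, by simp, by simp, ?_, fun x hx y hy => ?_⟩
    · rw [List.isChain_append_cons_cons, List.isChain_cons_cons]
      exact ⟨hch.1, hps, hsq, hch.2.2⟩
    · refine hL'.closed x (by cases L₁ <;> simpa using hx) y ?_
      simpa [List.getLast?_append] using hy

/-- A path in `ℱ_N` which contracts to a vertex is the image of a closed path in the Farey graph
of `ℤ`, provided that its initial vertex lifts. -/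
theorem exists_closedIntPath_of_contracts {γ : List (FareyVertex (ZMod N))}
    {x : FareyVertex (ZMod N)} (hγ : γ.IsChain FareyAdj)
    (hom : Relation.ReflTransGen ElementaryHomotopy γ [x]) {p : UnimodularPair ℤ}
    (hp : γ.head? = some (frameVertex u v h p)) :
    ∃ L, L.map (frameVertex u v h) = γ ∧ IsClosedIntPath L := by
  induction hom using Relation.ReflTransGen.head_induction_on with
  | refl =>
    refine ⟨[p], by simpa using hp.symm, by simp, by simp, ?_⟩
    simp [det_self]
  | head hstep _ ih =>
    obtain ⟨L', rfl, hL'⟩ := ih (hstep.isChain hγ) (hstep.head?_eq ▸ hp)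
    exact hstep.exists_lift h hγ hL'

/-- Choice of signs: if the images of integer pairs represent a path with consecutive determinants
`1`, then the integer pairs can be multiplied by signs so that the same holds over `ℤ` and they
lift the path itself and not only its image in `ℱ_N`. -/
theorem exists_signs {n : ℕ} (P : ℕ → UnimodularPair ℤ) (δ : ℕ → UnimodularPair (ZMod N))
    (hδ : ∀ k < n, (δ k).det (δ (k + 1)) = 1)
    (hP : ∀ k < n, (P k).AdjUpToSign (P (k + 1)))
    (hPδ : ∀ k ≤ n, frameVertex u v h (P k) = FareyVertex.mk (δ k)) :
    ∃ s : ℕ → ℤˣ, (∀ k < n, (s k • P k).det (s (k + 1) • P (k + 1)) = 1) ∧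
      ∀ k ≤ n, ofFrame u v h (s k • P k) = δ k := by
  have hcast : (Units.map (Int.castRingHom (ZMod N)).toMonoidHom (-1)) = -1 := by ext; simp
  have hsign : ∀ k ≤ n, ∃ ε : ℤˣ, ofFrame u v h (ε • P k) = δ k := by
    intro k hk
    rcases FareyVertex.mk_eq_mk_iff.1 (hPδ k hk) with h1 | h1
    · exact ⟨1, by rw [one_smul, h1]⟩
    · exact ⟨-1, by rw [h1, ofFrame_units_smul, hcast]⟩
  obtain ⟨ε, hε⟩ := hsign 0 (Nat.zero_le n)
  have hd : ∀ k, ∃ d : ℤˣ, k < n → (P k).det (P (k + 1)) = d := by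
    intro k
    by_cases hk : k < n
    · rcases hP k hk with h1 | h1
      · exact ⟨1, fun _ => h1⟩
      · exact ⟨-1, fun _ => h1⟩
    · exact ⟨1, fun h => absurd h hk⟩
  choose d hd using hd
  let s : ℕ → ℤˣ := fun k => ε * ∏ i ∈ Finset.range k, d i
  have hs : ∀ k, s (k + 1) = s k * d k := fun k => by
    simp only [s, Finset.prod_range_succ, mul_assoc]
  have hdet : ∀ k < n, (s k • P k).det (s (k + 1) • P (k + 1)) = 1 := by
    intro k hk
    rw [det_smul_left, det_smul_right, hs, hd k hk]
    norm_cast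
    rw [show s k * (s k * d k * d k) = (s k * s k) * (d k * d k) by group]
    simp
  refine ⟨s, hdet, fun k => ?_⟩
  induction k with
  | zero => simpa [s] using hε
  | succ k ih =>
    intro hk
    obtain ⟨ε', hε'⟩ := hsign (k + 1) hk
    -- Two lifts of `δ (k + 1)` up to sign which both have determinant `1` with `δ k` agree.
    have h1 := det_ofFrame h (s k • P k) (s (k + 1) • P (k + 1))
    have h2 : s (k + 1) • P (k + 1) = (s (k + 1) * ε'⁻¹) • ε' • P (k + 1) := by
      rw [smul_smul, inv_mul_cancel_right]
    rw [hdet k hk, ih (by omega), h2, ofFrame_units_smul, hε', det_smul_right, hδ k hk] at h1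
    rw [h2, ofFrame_units_smul, hε']
    have h3 : Units.map (Int.castRingHom (ZMod N)).toMonoidHom (s (k + 1) * ε'⁻¹) = 1 := by
      ext
      simpa using h1
    rw [h3, one_smul]

end Lifting

/-! ### Lifting friezes -/

/-- Two bi-infinite paths with the same coefficients and the same initial edge agree. -/
theorem IsBiinfinitePath.eq_of_coeff_eq {R : Type*} [CommRing R] {δ δ' : ℤ → UnimodularPair R}
    (hδ : IsBiinfinitePath δ) (hδ' : IsBiinfinitePath δ') (h0 : δ 0 = δ' 0) (h1 : δ 1 = δ' 1)
    (ha : ∀ i, (δ (i - 1)).det (δ (i + 1)) = (δ' (i - 1)).det (δ' (i + 1))) (k : ℕ) :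
    δ k = δ' k := by
  induction k using Nat.twoStepInduction with
  | zero => exact h0
  | one => exact h1
  | more k ih ih' =>
    have key : ∀ p : UnimodularPair R, p.det (δ (k + 2 : ℕ)) = p.det (δ' (k + 2 : ℕ)) := fun p => by
      have e := hδ.det_succ p (k + 1 : ℕ)
      have e' := hδ'.det_succ p (k + 1 : ℕ)
      rw [ha, ih', show ((k + 1 : ℕ) : ℤ) - 1 = k by push_cast; ring, ih] at e
      rw [show ((k + 1 : ℕ) : ℤ) - 1 = k by push_cast; ring, ← e] at e'
      exact e'.symm
    refine ext_of_det (hδ 1) (key _) ?_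
    rw [det_swap, key, ← det_swap]

/-- If a semiregular frieze lifts to `ℤ`, then the corresponding paths contract: each of them is
the image of a closed path in the Farey graph of `ℤ` under a suitable frame. -/
theorem IsLiftOf.isStronglyContractible {N n : ℕ} (hn : 2 ≤ n) {F : ℤ → ℤ → ZMod N}
    (hsemi : IsSemiregular F) {G : ℤ → ℤ → ℤ} (hG : IsTameFrieze n G) (hlift : IsLiftOf n G F)
    {γ : List (FareyVertex (ZMod N))} (hγ : Corresponds n γ F) : IsStronglyContractible γ := by
  obtain ⟨δ, ⟨hδ, -⟩, rfl, -, hext⟩ := hγ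
  obtain ⟨hG', hs⟩ := hG.normalize hn
  obtain ⟨P, hP, hP0, hP1, hPG⟩ := hG'.exists_path hs
  have h : (δ 0).det (δ 1) = 1 := hδ 1
  have hmap : ∀ k : ℕ, ofFrame (δ 0) (δ 1) h (P k) = δ k := by
    refine IsBiinfinitePath.eq_of_coeff_eq (δ := fun i => ofFrame (δ 0) (δ 1) h (P i))
      (fun i => ?_) hδ ?_ ?_ (fun i => ?_)
    · rw [det_ofFrame, hP i, Int.cast_one]
    · simp only [hP0]
      ext <;> simp [ofFrame]
    · simp only [hP1]
      ext <;> simp [ofFrame]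
    · have e1 := hPG (i + 1) (i - 1) (by omega) (by omega)
      have e2 := hext (i + 1) (i - 1) (by omega) (by omega)
      unfold pathTiling at e1 e2
      have h10 : ((G 1 0 : ℤ) : ZMod N) = 1 := by
        rw [hlift 1 0 (by omega) (by omega)]
        exact hsemi 0
      rw [det_ofFrame, e1, e2, Int.cast_mul, h10, one_mul,
        hlift (i + 1) (i - 1) (by omega) (by omega)]
  have hvert : ∀ k : ℕ, FareyVertex.mk (δ k) = frameVertex (δ 0) (δ 1) h (P k) := fun k => by
    rw [frameVertex, hmap]
  have hdet : (P 0).det (P n) = 0 := by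
    have e := hPG n 0 (by omega) (by omega)
    have hb := hG'.bottom_zero 0
    rw [add_zero] at hb
    exact e.trans hb
  have hadj : ∀ i, (P (i - 1)).AdjUpToSign (P i) := fun i => .inl (hP i)
  have hclosed : IsClosedIntPath ((List.range (n + 1)).map fun k : ℕ => P k) := by
    refine ⟨by simp, ?_, ?_⟩
    · rw [List.isChain_map, List.isChain_range_succ]
      intro m _
      simpa using hadj (m + 1)
    · simpa [List.head?_range, List.getLast?_range] using hdet
  have hlist : (List.range (n + 1)).map (fun k : ℕ => FareyVertex.mk (δ k)) =
      ((List.range (n + 1)).map fun k : ℕ => P k).map (frameVertex (δ 0) (δ 1) h) := by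
    simp [hvert]
  refine ⟨⟨⟨by simp, ?_⟩, ?_⟩, hlist ▸ hclosed.contracts h⟩
  · rw [hlist, List.isChain_map]
    exact hclosed.chain.imp fun _ _ => fareyAdj_frameVertex h
  · have e := frameVertex_eq_of_det_eq_zero h hdet
    have e0 := hvert 0
    rw [Nat.cast_zero] at e0
    simp [List.head?_range, List.getLast?_range, hvert n, e0, e]

/-- A finite sequence whose last term is `μ • q 0` has a quasi-periodic extension to `ℤ`. -/
theorem exists_quasiperiodic_extension {G X : Type*} [Group G] [MulAction G X] {n : ℕ}
    (hn : 0 < n) (q : ℕ → X) (μ : G) (hq : q n = μ • q 0) :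
    ∃ Q : ℤ → X, ∀ (m : ℤ) (r : ℕ), r ≤ n → Q (n * m + r) = μ ^ m • q r := by
  have hlt : ∀ (m : ℤ) (r : ℕ), r < n →
      μ ^ ((n * m + r) / n : ℤ) • q ((n * m + r) % n : ℤ).toNat = μ ^ m • q r := by
    intro m r hr
    have h1 : ((n : ℤ) * m + r) / n = m := by
      rw [Int.add_comm, Int.add_mul_ediv_left _ _ (by omega),
        Int.ediv_eq_zero_of_lt (by omega) (by omega), zero_add]
    have h2 : ((n : ℤ) * m + r) % n = r := by
      rw [Int.mul_add_emod_self_left, Int.emod_eq_of_lt (by omega) (by omega)]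
    rw [h1, h2, Int.toNat_natCast]
  refine ⟨fun i => μ ^ (i / n) • q (i % n).toNat, fun m r hr => ?_⟩
  rcases hr.lt_or_eq with hr | rfl
  · exact hlt m r hr
  · have := hlt (m + 1) 0 hn
    rw [zpow_add_one, mul_smul, ← hq, Nat.cast_zero, add_zero, mul_add, mul_one] at this
    exact this

/-- If an integer list lifts the initial segment of a path between equivalent vertices, then the
whole bi-infinite path lifts to a path between equivalent vertices over `ℤ`. -/
theorem exists_integral_path {N n : ℕ} (hn : 0 < n) {δ : ℤ → UnimodularPair (ZMod N)}
    (hδ : IsPathBetweenEquivalent n δ) {u v : UnimodularPair (ZMod N)} (h : u.det v = 1)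
    {L : List (UnimodularPair ℤ)} (hL : IsClosedIntPath L)
    (hLδ : L.map (frameVertex u v h) =
      (List.range (n + 1)).map (fun k : ℕ => FareyVertex.mk (δ k))) :
    ∃ Q : ℤ → UnimodularPair ℤ, IsBiinfinitePath Q ∧ (∀ i, (Q i).det (Q (i + n)) = 0) ∧
      ∀ i, ofFrame u v h (Q i) = δ i := by
  have hlen : L.length = n + 1 := by simpa using congrArg List.length hLδ
  obtain ⟨P, hP⟩ : ∃ P : ℕ → UnimodularPair ℤ, L = (List.range (n + 1)).map P := by
    refine ⟨fun k => L.getD k ⟨1, 0, isCoprime_one_left⟩, List.ext_getElem (by simp [hlen]) ?_⟩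
    intro k hk _
    simp [hk]
  subst hP
  have hchain : ∀ k < n, (P k).AdjUpToSign (P (k + 1)) := by
    have := hL.chain
    rwa [List.isChain_map, List.isChain_range_succ] at this
  have hclosed : (P 0).det (P n) = 0 :=
    hL.closed _ (by simp [List.head?_range]) _ (by simp [List.getLast?_range])
  have hPδ : ∀ k ≤ n, frameVertex u v h (P k) = FareyVertex.mk (δ k) := by
    intro k hk
    rw [List.map_map] at hLδ
    exact List.map_inj_left.1 hLδ k (by simpa using Nat.lt_succ_of_le hk)
  have hδdet : ∀ k : ℕ, (δ k).det (δ (k + 1 : ℕ)) = 1 := fun k => by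
    simpa using hδ.1 (k + 1)
  obtain ⟨s, hdet, hs⟩ := exists_signs h P (fun k => δ k) (fun k _ => hδdet k) hchain hPδ
  obtain ⟨μ, hμ⟩ := exists_units_smul_eq_of_det_eq_zero
    (p := s 0 • P 0) (q := s n • P n) (by simp [hclosed])
  obtain ⟨Q, hQ⟩ := exists_quasiperiodic_extension hn (fun k => s k • P k) μ hμ.symm
  have hdecomp : ∀ i : ℤ, ∃ (m : ℤ) (r : ℕ), r < n ∧ i = n * m + r := fun i => by
    have h1 := Int.emod_nonneg i (b := n) (by omega)
    have h2 := Int.emod_lt_of_pos i (b := n) (by omega)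
    have h3 := Int.mul_ediv_add_emod i n
    exact ⟨i / n, (i % n).toNat, by omega, by omega⟩
  have hper : ∀ i, Q (i + n) = μ • Q i := by
    intro i
    obtain ⟨m, r, hr, rfl⟩ := hdecomp i
    rw [show (n * m + r + n : ℤ) = n * (m + 1) + r by ring, hQ _ r hr.le, hQ _ r hr.le,
      zpow_add_one, mul_comm, mul_smul]
  -- The multiplier of `δ` is the residue of `μ`, so it is its own inverse.
  obtain ⟨-, c, hc⟩ := hδ
  set ν : (ZMod N)ˣ := Units.map (Int.castRingHom (ZMod N)).toMonoidHom μ with hν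
  have hcν : c = ν := by
    have h0 := hc 0
    have e0 := hs 0 (Nat.zero_le n)
    have en := hs n le_rfl
    rw [← hμ, ofFrame_units_smul, e0] at en
    rw [if_pos Even.zero, zero_add, ← en] at h0
    exact (smul_eq_smul_iff.1 h0).symm
  have hνinv : ν⁻¹ = ν := by
    rw [hν, ← map_inv, Int.units_inv_eq_self]
  have hδper : ∀ i, δ (i + n) = ν • δ i := by
    intro i
    rw [hc i, hcν, hνinv, ite_self]
  refine ⟨Q, fun i => ?_, fun i => by rw [hper, det_smul_right, det_self, mul_zero], fun i => ?_⟩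
  · obtain ⟨m, r, hr, hi⟩ := hdecomp (i - 1)
    have hi' : i = n * m + (r + 1 : ℕ) := by push_cast; linarith
    rw [hi, hi', hQ _ r hr.le, hQ _ (r + 1) hr, det_smul_left, det_smul_right, hdet r hr, mul_one]
    norm_cast
    simp
  · obtain ⟨m, r, hr, rfl⟩ := hdecomp i
    induction m using Int.induction_on with
    | zero =>
      have := hQ 0 r hr.le
      rw [mul_zero, zero_add, zpow_zero, one_smul] at this
      rw [mul_zero, zero_add, this]
      exact hs r hr.le
    | succ m ih =>
      rw [show (n * ((m : ℤ) + 1) + r : ℤ) = n * m + r + n by ring, hper, hδper,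
        ofFrame_units_smul, ih]
    | pred m ih =>
      rw [show (n * (-(m : ℤ)) + r : ℤ) = n * (-m - 1) + r + n by ring, hper, hδper,
        ofFrame_units_smul] at ih
      exact MulAction.injective ν ih

theorem theorem1p6 (N : ℕ) (hN : 2 ≤ N) (n : ℕ) (hn : 2 ≤ n) (F : ℤ → ℤ → ZMod N)
    (hF : IsTameFrieze n F) (hsemi : IsSemiregular F) :
    (∃ G : ℤ → ℤ → ℤ, IsTameFrieze n G ∧ IsLiftOf n G F) ↔
      ∀ γ : List (FareyVertex (ZMod N)), Corresponds n γ F → IsStronglyContractible γ := by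
  refine ⟨fun ⟨G, hG, hlift⟩ γ hγ => hlift.isStronglyContractible hn hsemi hG hγ, fun H => ?_⟩
  obtain ⟨δ, hδ, -, -, hδF⟩ := hF.exists_path hsemi
  have hδ' : IsPathBetweenEquivalent n δ := hδ.isPathBetweenEquivalent fun i => by
    have e := hδF (i + n) i (by omega) (by omega)
    rw [add_comm, hF.bottom_zero, add_comm] at e
    exact e
  obtain ⟨⟨⟨-, hchain⟩, -⟩, x, hx⟩ := H _ ⟨δ, hδ', rfl, pathTiling_isTameTiling hδ, hδF⟩
  have h : (δ 0).det (δ 1) = 1 := hδ 1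
  have hhead : ofFrame (δ 0) (δ 1) h ⟨1, 0, isCoprime_one_left⟩ = δ 0 := by
    ext <;> simp [ofFrame]
  obtain ⟨L, hL, hclosed⟩ := exists_closedIntPath_of_contracts h hchain hx
    (p := ⟨1, 0, isCoprime_one_left⟩) (by simp [List.head?_range, frameVertex, hhead])
  obtain ⟨Q, hQ, hQper, hQδ⟩ := exists_integral_path (by omega) hδ' h hclosed hL
  refine ⟨pathTiling Q, pathTiling_isTameFrieze hQ hQper, fun i j hij hij' => ?_⟩
  rw [← hδF i j hij hij', pathTiling, pathTiling, ← hQδ i, ← hQδ j, det_ofFrame]
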